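/- **Notation.** For a measurable space $X$ let $\mathcal M(X)$, $\mathcal M_+(X)$, $\mathcal M_1(X)$ be the sets of finite signed measures, finite non-negative measures and probability measures on $X$ (for a topological space: on its Borel $\sigma$-algebra). A kernel on $X$ is a symmetric positive definite function $k:X\times X\to\mathbb R$; $H_k$ is its reproducing kernel Hilbert space, $\mathcal M^k(X)$ is the set of all $\mu\in\mathcal M(X)$ with $H_k\subseteq L_1(\mu)$, and for $\mu\in\mathcal M^k(X)$ the kernel mean embedding $\Phi_k(\mu)=\int k(\cdot,x)\,d\mu(x)\in H_k$ is the Pettis integral of $x\mapsto k(\cdot,x)$. A measurable kernel $k$ is called integrally strictly positive definite with respect to a set $\mathcal S\subseteq\mathcal M^k(X)$ if $\|\Phi_k(\mu)\|_{H_k}^2>0$ for all $\mu\in\mathcal S\setminus\{0\}$. Let $\Phi_\infty^+$ be the class of functions $\varphi(t)=\int_{[0,\infty)}e^{-st}\,d\nu(s)$, $t\ge 0$, where $\nu$ is a finite Borel measure on $[0,\infty)$ with $\nu\neq 0$ and $\operatorname{supp}\nu\neq\{0\}$. **Theorem.** Let $X$ be a locally compact Hausdorff space and let $k_1$ be a bounded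 continuous kernel on $X$ that is integrally strictly positive definite with respect to $\mathcal M(X)$ and whose RKHS $H_{k_1}$ is separable. Let $\varphi\in\Phi_\infty^+$. Then $$k_2(\mu,\nu)=\varphi\Big(\int_X\int_X k_1(x,x')\,d(\mu-\nu)(x)\,d(\mu-\nu)(x')\Big)=\varphi\big(\|\Phi_{k_1}(\mu)-\Phi_{k_1}(\nu)\|_{H_{k_1}}^2\big),\qquad \mu,\nu\in\mathcal M_+(X),$$ is a kernel on $\mathcal M_+(X)$, and the following hold. 1. If every finite Borel measure on $X$ is Radon (inner and outer regular), then $k_2$ restricted to $\mathcal M_1(X)$ is integrally strictly positive definite with respect to $\mathcal M(\mathcal M_1(X))$, where $\mathcal M_1(X)$ carries the topology of weak convergence (convergence of the integrals of all bounded continuous functions) and its Borel $\sigma$-algebra. 2. If $X$ is Polish, then $k_2$ is integrally strictly positive definite with respect to $\mathcal M(\mathcal M_+(X))$, where $\mathcal M_+(X)$ carries the topology of weak convergence and its Borel $\sigma$-algebra. -/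

import Mathlib

open MeasureTheory
open scoped NNReal

noncomputable section

/-- A kernel on `X`: a symmetric positive definite function `k : X × X → ℝ`, that is
`k x y = k y x` and `∑ i, ∑ j, c i * k (x i) (x j) * c j ≥ 0` for all finite families. -/
def IsKernel {X : Type*} (k : X → X → ℝ) : Prop :=
  (Matrix.of k).PosSemidef

/-- The kernel `k`, with its real values regarded as operators `ℝ →L[ℝ] ℝ` (multiplication by
`k x y`), which is the form in which Mathlib's reproducing kernel Hilbert spaces take kernels. -/
def kernelMatrix {X : Type*} (k : X → X → ℝ) : Matrix X X (ℝ →L[ℝ] ℝ) :=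
  Matrix.of fun x y ↦ k x y • ContinuousLinearMap.id ℝ ℝ

theorem IsKernel.posSemidef_kernelMatrix {X : Type*} {k : X → X → ℝ} (hk : IsKernel k) :
    (kernelMatrix k).PosSemidef := by
  have key := (RKHS.posSemidef_tfae (K := kernelMatrix k)).out 0 2
  rw [key]
  constructor
  · ext x y
    have h : k y x = k x y := by simpa using hk.1.apply x y
    simp [kernelMatrix, Matrix.conjTranspose_apply, h, ContinuousLinearMap.star_eq_adjoint,
      ContinuousLinearMap.adjoint_id]
  · intro v
    have h := hk.2 v
    simp [kernelMatrix] at h ⊢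
    rw [Finsupp.sum_comm] at h
    simpa [mul_comm, mul_left_comm, mul_assoc] using h

instance {X : Type*} (k : X → X → ℝ) [hk : Fact (IsKernel k)] : Fact (kernelMatrix k).PosSemidef :=
  ⟨hk.out.posSemidef_kernelMatrix⟩

/-- The reproducing kernel Hilbert space `H_k` of a kernel `k`: a Hilbert space whose elements
are (coerced to) real-valued functions on `X`. -/
abbrev KernelSpace {X : Type*} (k : X → X → ℝ) [Fact (IsKernel k)] : Type _ :=
  RKHS.OfKernel (kernelMatrix k)

/-- The canonical feature map `Φ_k : X → H_k`, `x ↦ k(·, x)`. -/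
def featureMap {X : Type*} (k : X → X → ℝ) [Fact (IsKernel k)] (x : X) : KernelSpace k :=
  RKHS.kerFun (KernelSpace k) x 1

theorem featureMap_apply {X : Type*} (k : X → X → ℝ) [Fact (IsKernel k)] (x y : X) :
    featureMap k x y = k y x := by
  rw [featureMap, RKHS.kerFun_apply, RKHS.OfKernel.kernel_ofKernel]
  simp [kernelMatrix]

theorem inner_featureMap {X : Type*} (k : X → X → ℝ) [Fact (IsKernel k)] (f : KernelSpace k)
    (x : X) : inner ℝ f (featureMap k x) = f x := by
  rw [featureMap, RKHS.inner_kerFun]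
  simp

/-- `i` is a Pettis integral of `f` with respect to the finite signed measure `μ`: `f` is weakly
integrable and `⟪w, i⟫ = ∫ ⟪w, f x⟫ dμ(x)` for all `w`. -/
def IsPettisIntegral {X H : Type*} [MeasurableSpace X] [NormedAddCommGroup H]
    [InnerProductSpace ℝ H] (f : X → H) (μ : SignedMeasure X) (i : H) : Prop :=
  ∀ w : H, μ.Integrable (fun x ↦ (inner ℝ w (f x) : ℝ)) ∧
    (inner ℝ w i : ℝ) = ∫ᵛ x, (inner ℝ w (f x) : ℝ) ∂<•μ

theorem IsPettisIntegral.unique {X H : Type*} [MeasurableSpace X] [NormedAddCommGroup H]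
    [InnerProductSpace ℝ H] {f : X → H} {μ : SignedMeasure X} {i j : H}
    (hi : IsPettisIntegral f μ i) (hj : IsPettisIntegral f μ j) : i = j :=
  ext_inner_left ℝ fun w ↦ (hi w).2.trans (hj w).2.symm

open scoped Classical in
/-- The Pettis integral of `f` with respect to `μ` (and `0` if there is none). -/
def pettisIntegral {X H : Type*} [MeasurableSpace X] [NormedAddCommGroup H]
    [InnerProductSpace ℝ H] (f : X → H) (μ : SignedMeasure X) : H :=
  if h : ∃ i, IsPettisIntegral f μ i then h.choose else 0

/-- The set `M^k(X)` of all finite signed measures `μ` with `H_k ⊆ L₁(μ)`. -/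
def embeddableMeasures {X : Type*} [MeasurableSpace X] (k : X → X → ℝ) [Fact (IsKernel k)] :
    Set (SignedMeasure X) :=
  {μ | ∀ f : KernelSpace k, μ.Integrable (f : X → ℝ)}

/-- The kernel mean embedding `Φ_k(μ) = ∫ k(·, x) dμ(x) ∈ H_k`, a Pettis integral. -/
def kernelMeanEmbedding {X : Type*} [MeasurableSpace X] (k : X → X → ℝ) [Fact (IsKernel k)]
    (μ : SignedMeasure X) : KernelSpace k :=
  pettisIntegral (featureMap k) μ

/-- `k` is integrally strictly positive definite with respect to the set `S` of finite signed
measures: `k` is a measurable kernel, `S ⊆ M^k(X)`, and `‖Φ_k(μ)‖² > 0` for all `μ ∈ S`, `μ ≠ 0`. -/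
def IsIntegrallyStrictlyPosDef {X : Type*} [mX : MeasurableSpace X] (k : X → X → ℝ)
    (S : Set (SignedMeasure X)) : Prop :=
  Measurable (Function.uncurry k) ∧ ∃ _ : Fact (IsKernel k),
    S ⊆ embeddableMeasures k ∧ ∀ μ ∈ S, μ ≠ 0 → 0 < ‖kernelMeanEmbedding k μ‖ ^ 2

/-- The class `Φ_∞⁺`: functions that are on `[0, ∞)` the Laplace transform of a finite Borel measure
`ν` on `[0, ∞)` with `ν ≠ 0` and `supp ν ≠ {0}`. Values at negative arguments are irrelevant. -/
def PhiInftyPlus : Set (ℝ → ℝ) :=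
  {φ | ∃ ν : Measure ℝ≥0, IsFiniteMeasure ν ∧ ν ≠ 0 ∧ ν.support ≠ {0} ∧
    ∀ t : ℝ, 0 ≤ t → φ t = ∫ s : ℝ≥0, Real.exp (-((s : ℝ) * t)) ∂ν}

/-- The double integral `∫∫ k(x, x') dσ(x) dσ(x')` against a finite signed measure `σ`. -/
def kernelEnergy {X : Type*} [MeasurableSpace X] (k : X → X → ℝ) (σ : SignedMeasure X) : ℝ :=
  ∫ᵛ x', (∫ᵛ x, k x x' ∂<•σ) ∂<•σ

/-- The kernel `k₂(μ, ν) = φ(∫∫ k₁(x, x') d(μ - ν)(x) d(μ - ν)(x'))` on the set `M₊(X)` of finite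
non-negative measures. -/
def deepKernel {X : Type*} [MeasurableSpace X] (k₁ : X → X → ℝ) (φ : ℝ → ℝ)
    (μ ν : FiniteMeasure X) : ℝ :=
  φ (kernelEnergy k₁
    ((μ : Measure X).toSignedMeasure - (ν : Measure X).toSignedMeasure))

/-- The restriction of `k₂` to the set `M₁(X)` of probability measures. -/
def deepKernelProb {X : Type*} [MeasurableSpace X] (k₁ : X → X → ℝ) (φ : ℝ → ℝ)
    (μ ν : ProbabilityMeasure X) : ℝ :=
  deepKernel k₁ φ μ.toFiniteMeasure ν.toFiniteMeasure

end

open Filter Topology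

/-! Write `H` for the RKHS of `k₁`, `Φ` for the mean embedding, and `G(u, v) = ∫ exp(-s‖u - v‖²)
dν(s)`. Then `k₂(μ, ρ) = G(Φ μ, Φ ρ)`, which gives the kernel property. By the Jordan decomposition,
strictness means that zero energy of `p - q` forces `p = q` for finite measures `p`, `q`. The energy
of `k₂` at `p - q` is the energy of `G` at the difference of the push-forwards under `Φ`, so two
facts suffice.

First, `G` is strict on the separable Hilbert space `H`
(`isIntegrallyStrictlyPosDef_gaussianMixture`). Its energy is the `ν`-integral of the nonnegative
Gaussian energies. If it vanishes, some Gaussian energy with `s > 0` vanishes, because `ν` charges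
`(0, ∞)`. Expanding the square turns this into equality of the Laplace transforms of the two
measures weighted by `exp(-s‖u‖²)`; analytic continuation then gives equal characteristic functions.

Second, push-forward under `Φ` is injective on finite measures (`measure_eq_of_map_eq`). The map `Φ`
is injective because `k₁` is strict, but only its weak continuity is available. This still makes
images of compact sets closed in `H`, so `p` and `q` agree on compact sets. Agreement on all Borel
sets follows from tightness (`exists_isCompact_measure_compl_le`), a Prokhorov argument applied to
the average of the random measures. -/

/-! ### Closure properties of kernels -/

theorem isKernel_iff {X : Type*} {k : X → X → ℝ} :
    IsKernel k ↔ (∀ x y, k x y = k y x) ∧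
      ∀ c : X →₀ ℝ, 0 ≤ ∑ x ∈ c.support, ∑ y ∈ c.support, c x * k x y * c y := by
  rw [IsKernel, Matrix.PosSemidef]
  refine and_congr ⟨fun h x y ↦ by simpa using h.apply y x, fun h ↦ ?_⟩ (by simp [Finsupp.sum])
  ext x y
  simpa using h y x

theorem IsKernel.symm {X : Type*} {k : X → X → ℝ} (hk : IsKernel k) (x y : X) : k x y = k y x :=
  (isKernel_iff.1 hk).1 x y

theorem IsKernel.comp {X Y : Type*} {k : X → X → ℝ} (hk : IsKernel k) (f : Y → X) :
    IsKernel fun x y ↦ k (f x) (f y) :=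
  Matrix.PosSemidef.submatrix hk f

theorem IsKernel.mul {X : Type*} {k l : X → X → ℝ} (hk : IsKernel k) (hl : IsKernel l) :
    IsKernel fun x y ↦ k x y * l x y :=
  Matrix.PosSemidef.hadamard hk hl

theorem IsKernel.of_mul_self {X : Type*} (f : X → ℝ) : IsKernel fun x y ↦ f x * f y := by
  refine isKernel_iff.2 ⟨fun x y ↦ mul_comm _ _, fun c ↦ ?_⟩
  have : ∑ x ∈ c.support, ∑ y ∈ c.support, c x * (f x * f y) * c y =
      (∑ x ∈ c.support, c x * f x) ^ 2 := by
    rw [sq, Finset.sum_mul_sum]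
    exact Finset.sum_congr rfl fun x _ ↦ Finset.sum_congr rfl fun y _ ↦ by ring
  rw [this]
  positivity

theorem IsKernel.add {X : Type*} {k l : X → X → ℝ} (hk : IsKernel k) (hl : IsKernel l) :
    IsKernel fun x y ↦ k x y + l x y :=
  Matrix.PosSemidef.add hk hl

theorem IsKernel.const_mul {X : Type*} {k : X → X → ℝ} (hk : IsKernel k) {a : ℝ} (ha : 0 ≤ a) :
    IsKernel fun x y ↦ a * k x y := by
  convert (IsKernel.of_mul_self fun _ : X ↦ √a).mul hk using 3
  rw [Real.mul_self_sqrt ha]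

theorem IsKernel.pow {X : Type*} {k : X → X → ℝ} (hk : IsKernel k) (n : ℕ) :
    IsKernel fun x y ↦ k x y ^ n := by
  induction n with
  | zero => simpa using IsKernel.of_mul_self fun _ : X ↦ (1 : ℝ)
  | succ n ih => simpa only [pow_succ] using ih.mul hk

theorem IsKernel.finset_sum {X ι : Type*} {k : ι → X → X → ℝ} (s : Finset ι)
    (hk : ∀ i ∈ s, IsKernel (k i)) : IsKernel fun x y ↦ ∑ i ∈ s, k i x y := by
  classical
  induction s using Finset.induction_on with
  | empty => simpa using IsKernel.of_mul_self fun _ : X ↦ (0 : ℝ)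
  | insert a s ha ih =>
    simpa only [Finset.sum_insert ha] using (hk a (by simp)).add
      (ih fun i hi ↦ hk i (by simp [hi]))

theorem IsKernel.of_tendsto {X ι : Type*} {l : Filter ι} [l.NeBot] {k : ι → X → X → ℝ}
    {k' : X → X → ℝ} (hk : ∀ i, IsKernel (k i))
    (h : ∀ x y, Tendsto (fun i ↦ k i x y) l (𝓝 (k' x y))) : IsKernel k' := by
  refine isKernel_iff.2 ⟨fun x y ↦ tendsto_nhds_unique (h x y)
    (by simpa only [fun i ↦ (hk i).symm x y] using h y x), fun c ↦ ?_⟩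
  refine ge_of_tendsto' (tendsto_finsetSum _ fun x _ ↦ tendsto_finsetSum _ fun y _ ↦
    ((h x y).const_mul (c x)).mul_const (c y)) fun i ↦ (isKernel_iff.1 (hk i)).2 c

theorem IsKernel.exp {X : Type*} {k : X → X → ℝ} (hk : IsKernel k) :
    IsKernel fun x y ↦ Real.exp (k x y) := by
  refine IsKernel.of_tendsto (l := atTop)
    (k := fun n x y ↦ ∑ i ∈ Finset.range n, (Nat.factorial i : ℝ)⁻¹ * k x y ^ i)
    (fun n ↦ IsKernel.finset_sum _ fun i _ ↦ (hk.pow i).const_mul (by positivity)) fun x y ↦ ?_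
  have := (NormedSpace.expSeries_div_hasSum_exp (k x y)).tendsto_sum_nat
  simpa [div_eq_inv_mul, Real.exp_eq_exp_ℝ] using this

theorem IsKernel.inner (H : Type*) [NormedAddCommGroup H] [InnerProductSpace ℝ H] :
    IsKernel fun u v : H ↦ (inner ℝ u v : ℝ) := by
  refine isKernel_iff.2 ⟨fun x y ↦ (real_inner_comm _ _), fun c ↦ ?_⟩
  have : ∑ x ∈ c.support, ∑ y ∈ c.support, c x * (Inner.inner ℝ x y : ℝ) * c y =
      Inner.inner ℝ (∑ x ∈ c.support, c x • x) (∑ x ∈ c.support, c x • x) := by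
    simp only [sum_inner, inner_sum, real_inner_smul_left, real_inner_smul_right]
    refine Finset.sum_congr rfl fun x _ ↦ Finset.sum_congr rfl fun y _ ↦ ?_
    rw [real_inner_comm]
    ring
  rw [this]
  exact real_inner_self_nonneg

theorem IsKernel.integral {X S : Type*} [MeasurableSpace S] {ν : Measure S} {k : S → X → X → ℝ}
    (hk : ∀ s, IsKernel (k s)) (hint : ∀ x y, Integrable (fun s ↦ k s x y) ν) :
    IsKernel fun x y ↦ ∫ s, k s x y ∂ν := by
  refine isKernel_iff.2 ⟨fun x y ↦ by simp only [fun s ↦ (hk s).symm x y], fun c ↦ ?_⟩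
  have : ∑ x ∈ c.support, ∑ y ∈ c.support, c x * (∫ s, k s x y ∂ν) * c y =
      ∫ s, ∑ x ∈ c.support, ∑ y ∈ c.support, c x * k s x y * c y ∂ν := by
    have hi (x y : X) : Integrable (fun s ↦ c x * k s x y * c y) ν :=
      ((hint x y).const_mul _).mul_const _
    rw [integral_finsetSum _ fun x _ ↦ integrable_finsetSum _ fun y _ ↦ hi x y]
    refine Finset.sum_congr rfl fun x _ ↦ ?_
    rw [integral_finsetSum _ fun y _ ↦ hi x y]
    simp only [integral_mul_const, integral_const_mul]
  rw [this]
  exact integral_nonneg fun s ↦ (isKernel_iff.1 (hk s)).2 c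

/-- The Gaussian kernel `exp (-s ‖u - v‖²)`. -/
noncomputable def gaussianKernel {H : Type*} [NormedAddCommGroup H] (s : ℝ) (u v : H) : ℝ :=
  Real.exp (-(s * ‖u - v‖ ^ 2))

/-- The factorisation serves twice: the exponential of the inner product gives positive
definiteness, and it links Gaussian integrals to Laplace transforms. -/
theorem gaussianKernel_eq {H : Type*} [NormedAddCommGroup H] [InnerProductSpace ℝ H] (s : ℝ)
    (u v : H) : gaussianKernel s u v = Real.exp (-(s * ‖u‖ ^ 2)) * Real.exp (-(s * ‖v‖ ^ 2)) *
      Real.exp (2 * s * inner ℝ u v) := by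
  rw [gaussianKernel, ← Real.exp_add, ← Real.exp_add, norm_sub_sq_real]
  ring_nf

theorem isKernel_gaussianKernel {H : Type*} [NormedAddCommGroup H] [InnerProductSpace ℝ H]
    {s : ℝ} (hs : 0 ≤ s) : IsKernel (gaussianKernel s : H → H → ℝ) := by
  have := (IsKernel.of_mul_self fun u : H ↦ Real.exp (-(s * ‖u‖ ^ 2))).mul
    ((IsKernel.inner H).const_mul (a := 2 * s) (by positivity)).exp
  convert this using 2 with u v
  ext v
  exact gaussianKernel_eq s u v

theorem abs_gaussianKernel_le {H : Type*} [NormedAddCommGroup H] {s : ℝ} (hs : 0 ≤ s) (u v : H) :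
    |gaussianKernel s u v| ≤ 1 := by
  rw [gaussianKernel, abs_of_pos (Real.exp_pos _), Real.exp_le_one_iff]
  have : 0 ≤ s * ‖u - v‖ ^ 2 := by positivity
  linarith

/-! ### Kernel mean embeddings for bounded measurable kernels -/

/-- Finite combinations of the functions `k(·, x)` are dense, and norm convergence in an RKHS
implies pointwise convergence. -/
theorem KernelSpace.measurable {Y : Type*} [MeasurableSpace Y] {k : Y → Y → ℝ} [Fact (IsKernel k)]
    (hk : Measurable (Function.uncurry k)) (f : KernelSpace k) : Measurable (f : Y → ℝ) := by
  have hf : f ∈ closure (Submodule.span ℝ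
      {RKHS.kerFun (KernelSpace k) x v | (x) (v)} : Set (KernelSpace k)) := by
    have := RKHS.kerFun_dense (KernelSpace k)
    rw [← Submodule.topologicalClosure_coe, this]
    trivial
  obtain ⟨g, hg, hlim⟩ := mem_closure_iff_seq_limit.1 hf
  refine measurable_of_tendsto_metrizable (f := fun n ↦ (g n : Y → ℝ)) (fun n ↦ ?_)
    (tendsto_pi_nhds.2 fun y ↦ ((RKHS.continuous_eval y).tendsto f).comp hlim)
  have hgn : g n ∈ Submodule.span ℝ {RKHS.kerFun (KernelSpace k) x v | (x) (v)} := hg n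
  generalize g n = f at hgn
  induction hgn using Submodule.span_induction with
  | mem f hf =>
    obtain ⟨x, v, rfl⟩ := hf
    have : (RKHS.kerFun (KernelSpace k) x v : Y → ℝ) = fun y ↦ k y x * v := by
      ext y
      rw [RKHS.kerFun_apply, RKHS.OfKernel.kernel_ofKernel]
      simp [kernelMatrix]
    rw [this]
    exact (hk.comp (measurable_id.prodMk measurable_const)).mul_const v
  | zero => rw [RKHS.coe_zero]; exact measurable_const
  | add f g _ _ hf hg => rw [RKHS.coe_add]; exact hf.add hg
  | smul c f _ hf => rw [RKHS.coe_smul]; exact hf.const_smul c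

theorem norm_featureMap_sq {Y : Type*} (k : Y → Y → ℝ) [Fact (IsKernel k)] (x : Y) :
    ‖featureMap k x‖ ^ 2 = k x x := by
  rw [← real_inner_self_eq_norm_sq, inner_featureMap, featureMap_apply]

theorem KernelSpace.abs_apply_le {Y : Type*} {k : Y → Y → ℝ} [Fact (IsKernel k)]
    {C : ℝ} (hC : ∀ x y, |k x y| ≤ C) (f : KernelSpace k) (y : Y) : |f y| ≤ ‖f‖ * √C := by
  rw [← inner_featureMap]
  refine (abs_real_inner_le_norm _ _).trans (mul_le_mul_of_nonneg_left ?_ (norm_nonneg _))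
  refine Real.le_sqrt_of_sq_le ?_
  rw [norm_featureMap_sq]
  exact (le_abs_self _).trans (hC y y)

instance {Y : Type*} [MeasurableSpace Y] (σ : SignedMeasure Y) : IsFiniteMeasure σ.variation := by
  rw [← SignedMeasure.totalVariation_eq_variation]
  unfold SignedMeasure.totalVariation
  infer_instance

theorem KernelSpace.integrable {Y : Type*} [MeasurableSpace Y] {k : Y → Y → ℝ} [Fact (IsKernel k)]
    (hk : Measurable (Function.uncurry k)) {C : ℝ} (hC : ∀ x y, |k x y| ≤ C)
    (μ : Measure Y) [IsFiniteMeasure μ] (f : KernelSpace k) : Integrable (f : Y → ℝ) μ :=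
  Integrable.of_bound (KernelSpace.measurable hk f).aestronglyMeasurable (‖f‖ * √C)
    (.of_forall fun y ↦ KernelSpace.abs_apply_le hC f y)

theorem embeddableMeasures_eq_univ {Y : Type*} [MeasurableSpace Y] {k : Y → Y → ℝ}
    [Fact (IsKernel k)] (hk : Measurable (Function.uncurry k)) {C : ℝ}
    (hC : ∀ x y, |k x y| ≤ C) : embeddableMeasures k = Set.univ :=
  Set.eq_univ_of_forall fun σ f ↦ KernelSpace.integrable hk hC σ.variation f

/-- Integration against `σ` is a bounded functional on the RKHS, so the Riesz representation theorem
supplies the Pettis integral. -/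
theorem inner_kernelMeanEmbedding {Y : Type*} [MeasurableSpace Y] {k : Y → Y → ℝ}
    [Fact (IsKernel k)] (hk : Measurable (Function.uncurry k)) {C : ℝ}
    (hC : ∀ x y, |k x y| ≤ C) (σ : SignedMeasure Y) (f : KernelSpace k) :
    inner ℝ f (kernelMeanEmbedding k σ) = ∫ᵛ x, f x ∂<•σ := by
  have hint := KernelSpace.integrable hk hC σ.variation
  let L : KernelSpace k →L[ℝ] ℝ := LinearMap.mkContinuous
    { toFun := fun f ↦ ∫ᵛ x, f x ∂<•σ
      map_add' := fun f g ↦ by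
        simp only [RKHS.coe_add, Pi.add_apply]
        exact VectorMeasure.integral_fun_add (hint f) (hint g)
      map_smul' := fun c f ↦ by
        simp only [RKHS.coe_smul, Pi.smul_apply]
        exact VectorMeasure.integral_fun_smul σ _ c f }
    (‖(ContinuousLinearMap.lsmul ℝ ℝ (E := ℝ)).flip‖ * (√C * σ.variation.real Set.univ))
    fun f ↦ by
      refine VectorMeasure.norm_integral_le_integral_norm.trans ?_
      have : ∫ a, ‖f a‖ ∂σ.variation ≤ ∫ _, ‖f‖ * √C ∂σ.variation :=
        integral_mono (hint f).norm (integrable_const _) fun y ↦ KernelSpace.abs_apply_le hC f y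
      rw [integral_const, smul_eq_mul] at this
      rw [mul_assoc]
      refine mul_le_mul_of_nonneg_left (this.trans_eq ?_) (by positivity)
      ring
  have hex : ∃ i, IsPettisIntegral (featureMap k) σ i := by
    refine ⟨(InnerProductSpace.toDual ℝ (KernelSpace k)).symm L, fun w ↦ ⟨?_, ?_⟩⟩
    · simpa only [inner_featureMap] using hint w
    · rw [real_inner_comm, InnerProductSpace.toDual_symm_apply]
      simp only [inner_featureMap]
      rfl
  have h := hex.choose_spec f
  rw [kernelMeanEmbedding, pettisIntegral, dif_pos hex, h.2]
  simp only [inner_featureMap]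

theorem kernelMeanEmbedding_apply {Y : Type*} [MeasurableSpace Y] {k : Y → Y → ℝ}
    [Fact (IsKernel k)] (hk : Measurable (Function.uncurry k)) {C : ℝ}
    (hC : ∀ x y, |k x y| ≤ C) (σ : SignedMeasure Y) (y : Y) :
    kernelMeanEmbedding k σ y = ∫ᵛ x, k x y ∂<•σ := by
  rw [← inner_featureMap, real_inner_comm, inner_kernelMeanEmbedding hk hC]
  simp only [featureMap_apply]

theorem kernelEnergy_eq_norm_sq {Y : Type*} [MeasurableSpace Y] {k : Y → Y → ℝ}
    [Fact (IsKernel k)] (hk : Measurable (Function.uncurry k)) {C : ℝ}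
    (hC : ∀ x y, |k x y| ≤ C) (σ : SignedMeasure Y) :
    kernelEnergy k σ = ‖kernelMeanEmbedding k σ‖ ^ 2 := by
  rw [← real_inner_self_eq_norm_sq, inner_kernelMeanEmbedding hk hC, kernelEnergy]
  simp only [kernelMeanEmbedding_apply hk hC]

theorem kernelMeanEmbedding_sub {Y : Type*} [MeasurableSpace Y] {k : Y → Y → ℝ}
    [Fact (IsKernel k)] (hk : Measurable (Function.uncurry k)) {C : ℝ}
    (hC : ∀ x y, |k x y| ≤ C) (σ τ : SignedMeasure Y) :
    kernelMeanEmbedding k (σ - τ) = kernelMeanEmbedding k σ - kernelMeanEmbedding k τ := by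
  refine ext_inner_left ℝ fun f ↦ ?_
  simp only [inner_sub_right, inner_kernelMeanEmbedding hk hC]
  exact VectorMeasure.integral_sub_vectorMeasure (KernelSpace.integrable hk hC _ f)
    (KernelSpace.integrable hk hC _ f)

theorem integral_toSignedMeasure_sub {Y : Type*} [MeasurableSpace Y] {p q : Measure Y}
    [IsFiniteMeasure p] [IsFiniteMeasure q] {f : Y → ℝ} (hp : Integrable f p)
    (hq : Integrable f q) :
    ∫ᵛ x, f x ∂<•(p.toSignedMeasure - q.toSignedMeasure) = ∫ x, f x ∂p - ∫ x, f x ∂q := by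
  rw [VectorMeasure.integral_sub_vectorMeasure]
  · simp
  · simpa [VectorMeasure.Integrable] using hp
  · simpa [VectorMeasure.Integrable] using hq

/-- Reduces the energy to integrals over products of nonnegative measures, where push-forward and
Fubini apply. -/
theorem kernelEnergy_toSignedMeasure_sub {Y : Type*} [MeasurableSpace Y] {k : Y → Y → ℝ}
    (hk : Measurable (Function.uncurry k)) {C : ℝ} (hC : ∀ x y, |k x y| ≤ C)
    (p q : Measure Y) [IsFiniteMeasure p] [IsFiniteMeasure q] :
    kernelEnergy k (p.toSignedMeasure - q.toSignedMeasure) =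
      (∫ z, k z.2 z.1 ∂p.prod p - ∫ z, k z.2 z.1 ∂p.prod q) -
      (∫ z, k z.2 z.1 ∂q.prod p - ∫ z, k z.2 z.1 ∂q.prod q) := by
  have hk' : Measurable fun z : Y × Y ↦ k z.2 z.1 := hk.comp measurable_swap
  have hprod (a b : Measure Y) [IsFiniteMeasure a] [IsFiniteMeasure b] :
      Integrable (fun z : Y × Y ↦ k z.2 z.1) (a.prod b) :=
    Integrable.of_bound hk'.aestronglyMeasurable C (.of_forall fun z ↦ hC _ _)
  have hone (a : Measure Y) [IsFiniteMeasure a] (y : Y) : Integrable (fun x ↦ k x y) a :=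
    Integrable.of_bound (hk.comp (measurable_id.prodMk measurable_const)).aestronglyMeasurable C
      (.of_forall fun z ↦ hC _ _)
  have hleft (a b : Measure Y) [IsFiniteMeasure a] [IsFiniteMeasure b] :
      Integrable (fun y ↦ ∫ x, k x y ∂b) a := (hprod a b).integral_prod_left
  simp only [kernelEnergy, integral_toSignedMeasure_sub (hone p _) (hone q _)]
  rw [integral_toSignedMeasure_sub (f := fun y ↦ ∫ x, k x y ∂p - ∫ x, k x y ∂q)
      ((hleft p p).sub (hleft p q)) ((hleft q p).sub (hleft q q)),
    integral_sub (hleft p p) (hleft p q), integral_sub (hleft q p) (hleft q q),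
    integral_prod _ (hprod p p), integral_prod _ (hprod p q), integral_prod _ (hprod q p),
    integral_prod _ (hprod q q)]

/-- The Jordan decomposition writes every signed measure as such a difference, so injectivity on
nonnegative measures is enough. -/
theorem IsIntegrallyStrictlyPosDef.of_kernelEnergy {Y : Type*} [MeasurableSpace Y]
    {k : Y → Y → ℝ} (hker : IsKernel k) (hk : Measurable (Function.uncurry k)) {C : ℝ}
    (hC : ∀ x y, |k x y| ≤ C)
    (h : ∀ (p q : Measure Y) [IsFiniteMeasure p] [IsFiniteMeasure q],
      kernelEnergy k (p.toSignedMeasure - q.toSignedMeasure) = 0 → p = q) :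
    IsIntegrallyStrictlyPosDef k Set.univ := by
  have : Fact (IsKernel k) := ⟨hker⟩
  refine ⟨hk, this, (embeddableMeasures_eq_univ hk hC).ge, fun σ _ hσ ↦ ?_⟩
  rw [← kernelEnergy_eq_norm_sq hk hC]
  refine lt_of_le_of_ne ?_ fun h0 ↦ hσ ?_
  · rw [kernelEnergy_eq_norm_sq hk hC]
    positivity
  · have hσ' := σ.toSignedMeasure_toJordanDecomposition
    rw [JordanDecomposition.toSignedMeasure] at hσ'
    have := h _ _ (by rw [hσ', h0])
    rw [← hσ', sub_eq_zero]
    simp only [this]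

theorem IsIntegrallyStrictlyPosDef.eq_of_kernelEnergy {Y : Type*} [MeasurableSpace Y]
    {k : Y → Y → ℝ} (h : IsIntegrallyStrictlyPosDef k Set.univ) {C : ℝ}
    (hC : ∀ x y, |k x y| ≤ C) {p q : Measure Y} [IsFiniteMeasure p] [IsFiniteMeasure q]
    (h0 : kernelEnergy k (p.toSignedMeasure - q.toSignedMeasure) = 0) : p = q := by
  obtain ⟨hk, _, -, hpos⟩ := h
  by_contra hne
  refine (hpos _ (Set.mem_univ (p.toSignedMeasure - q.toSignedMeasure)) fun h ↦ hne ?_).ne' ?_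
  · exact Measure.toSignedMeasure_eq_toSignedMeasure_iff.1 (sub_eq_zero.1 h)
  · rw [← kernelEnergy_eq_norm_sq hk hC, h0]

/-- Integral strict positive definiteness is inherited along a measurable map whose push-forward
is injective on finite measures. -/
theorem IsIntegrallyStrictlyPosDef.comp {Y Z : Type*} [MeasurableSpace Y] [MeasurableSpace Z]
    {k : Z → Z → ℝ} (h : IsIntegrallyStrictlyPosDef k Set.univ) {C : ℝ}
    (hC : ∀ x y, |k x y| ≤ C) {f : Y → Z} (hf : Measurable f)
    (hinj : ∀ (p q : Measure Y) [IsFiniteMeasure p] [IsFiniteMeasure q],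
      p.map f = q.map f → p = q) :
    IsIntegrallyStrictlyPosDef (fun x y ↦ k (f x) (f y)) Set.univ := by
  have hk := h.1
  have hk' : Measurable (Function.uncurry fun x y ↦ k (f x) (f y)) :=
    hk.comp ((hf.comp measurable_fst).prodMk (hf.comp measurable_snd))
  refine .of_kernelEnergy (h.2.1.out.comp f) hk' (fun x y ↦ hC _ _) ?_
  intro p q _ _ h0
  refine hinj p q (h.eq_of_kernelEnergy hC ?_)
  rw [← h0, kernelEnergy_toSignedMeasure_sub hk hC, 
    kernelEnergy_toSignedMeasure_sub hk' (fun x y ↦ hC _ _)]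
  have (a b : Measure Y) [IsFiniteMeasure a] [IsFiniteMeasure b] :
      ∫ z, k z.2 z.1 ∂(a.map f).prod (b.map f) = ∫ z, k (f z.2) (f z.1) ∂a.prod b := by
    rw [Measure.map_prod_map _ _ hf hf, integral_map (hf.prodMap hf).aemeasurable]
    · rfl
    · exact (hk.comp measurable_swap).aestronglyMeasurable
  simp only [this]

/-! ### Gaussian kernels on separable Hilbert spaces -/

section Gaussian

variable {H : Type*} [NormedAddCommGroup H] [SecondCountableTopology H] [MeasurableSpace H]
  [BorelSpace H]

/-- Finite measures on a separable Hilbert space with the same finite Laplace transform agree. -/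
theorem measure_ext_of_integral_exp_inner [InnerProductSpace ℝ H] [CompleteSpace H]
    {a b : Measure H} [IsFiniteMeasure a] [IsFiniteMeasure b]
    (ha : ∀ v : H, Integrable (fun u ↦ Real.exp (inner ℝ u v)) a)
    (h : ∀ v : H, ∫ u, Real.exp (inner ℝ u v) ∂a = ∫ u, Real.exp (inner ℝ u v) ∂b) : a = b := by
  refine Measure.ext_of_charFun (funext fun v ↦ ?_)
  have hmgf : ProbabilityTheory.mgf (fun u : H ↦ (inner ℝ u v : ℝ)) a =
      ProbabilityTheory.mgf (fun u : H ↦ (inner ℝ u v : ℝ)) b := by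
    ext t
    simpa [ProbabilityTheory.mgf, real_inner_smul_right] using h (t • v)
  have hzero : a = 0 ↔ b = 0 := by
    have h0 := h 0
    simp only [inner_zero_right, Real.exp_zero, integral_const, smul_eq_mul, mul_one] at h0
    rw [← Measure.measure_univ_eq_zero, ← Measure.measure_univ_eq_zero,
      ← measureReal_eq_zero_iff, h0, measureReal_eq_zero_iff]
  have hset : ProbabilityTheory.integrableExpSet (fun u : H ↦ (inner ℝ u v : ℝ)) a = Set.univ := by
    refine Set.eq_univ_of_forall fun t ↦ ?_
    simpa [ProbabilityTheory.integrableExpSet, real_inner_smul_right] using ha (t • v)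
  -- Exponential moments of all orders make the complex moment generating functions of `⟪u, v⟫`
  -- entire; equal on the real line, they agree at `I`, where they give the characteristic functions
  -- at `v`.
  have := ProbabilityTheory.eqOn_complexMGF_of_mgf' hmgf hzero (x := Complex.I) (by simp [hset])
  simpa [ProbabilityTheory.complexMGF, charFun_apply, mul_comm] using this

/-- With density `g(u) = exp(-s‖u‖²)`, the Gaussian integrals become Laplace transforms up to a
factor depending only on `v`. The density takes values in `(0, 1]`, so the weighted measures are
finite and the weight can be undone. -/
theorem measure_ext_of_integral_gaussianKernel [InnerProductSpace ℝ H] [CompleteSpace H]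
    {s : ℝ} (hs : 0 < s) {a b : Measure H}
    [IsFiniteMeasure a] [IsFiniteMeasure b]
    (h : ∀ v : H, ∫ u, gaussianKernel s u v ∂a = ∫ u, gaussianKernel s u v ∂b) : a = b := by
  set g : H → ℝ≥0 := fun u ↦ (Real.exp (-(s * ‖u‖ ^ 2))).toNNReal with hg
  have hgm : Measurable g := by fun_prop
  have hg0 (u : H) : (g u : ENNReal) ≠ 0 := by simp [hg, Real.exp_pos]
  have hg1 (u : H) : g u ≤ 1 := by
    rw [hg, Real.toNNReal_le_one, Real.exp_le_one_iff]
    have : 0 ≤ s * ‖u‖ ^ 2 := by positivity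
    linarith
  have hfin (m : Measure H) [IsFiniteMeasure m] : IsFiniteMeasure (m.withDensity fun u ↦ g u) := by
    refine isFiniteMeasure_withDensity (ne_of_lt ?_)
    refine (lintegral_mono fun u ↦ (by exact_mod_cast hg1 u : (g u : ENNReal) ≤ 1)).trans_lt ?_
    simp
  have := hfin a
  have := hfin b
  -- Centring the Gaussian at `v / (2s)` turns the cross term `2s⟪u, ·⟫` into `⟪u, v⟫`.
  have hv (u v : H) : (g u : ℝ) • Real.exp (inner ℝ u v) =
      gaussianKernel s u ((2 * s)⁻¹ • v) * Real.exp (s * ‖(2 * s)⁻¹ • v‖ ^ 2) := by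
    rw [gaussianKernel_eq, real_inner_smul_right, ← mul_assoc (2 * s),
      mul_inv_cancel₀ (by positivity), one_mul, hg, Real.coe_toNNReal _ (Real.exp_pos _).le,
      smul_eq_mul, mul_assoc, mul_assoc, mul_left_comm (Real.exp (-(s * ‖(2 * s)⁻¹ • v‖ ^ 2))),
      ← Real.exp_add (-(s * ‖(2 * s)⁻¹ • v‖ ^ 2)), neg_add_cancel, Real.exp_zero, mul_one]
  have key : a.withDensity (fun u ↦ g u) = b.withDensity fun u ↦ g u := by
    refine measure_ext_of_integral_exp_inner (fun v ↦ ?_) fun v ↦ ?_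
    · rw [integrable_withDensity_iff_integrable_smul hgm]
      simp only [NNReal.smul_def, hv]
      refine Integrable.mul_const (Integrable.of_bound ?_ 1
        (.of_forall fun u ↦ abs_gaussianKernel_le hs.le _ _)) _
      unfold gaussianKernel
      fun_prop
    · rw [integral_withDensity_eq_integral_smul hgm, integral_withDensity_eq_integral_smul hgm]
      simp only [NNReal.smul_def, hv, integral_mul_const, h]
  have hinv (m : Measure H) :
      ((m.withDensity fun u ↦ g u).withDensity fun u ↦ (g u : ENNReal)⁻¹) = m :=
    withDensity_inv_same hgm.coe_nnreal_ennreal (.of_forall hg0) (.of_forall fun u ↦ by simp)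
  rw [← hinv a, key, hinv]

theorem measurable_gaussianKernel (s : ℝ) :
    Measurable (Function.uncurry (gaussianKernel s : H → H → ℝ)) := by
  unfold gaussianKernel Function.uncurry
  fun_prop

theorem kernelEnergy_gaussianKernel_nonneg [InnerProductSpace ℝ H] {s : ℝ} (hs : 0 ≤ s)
    (σ : SignedMeasure H) :
    0 ≤ kernelEnergy (gaussianKernel s) σ := by
  have : Fact (IsKernel (gaussianKernel s : H → H → ℝ)) := ⟨isKernel_gaussianKernel hs⟩
  rw [kernelEnergy_eq_norm_sq (measurable_gaussianKernel s) (abs_gaussianKernel_le hs)]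
  positivity

theorem eq_of_kernelEnergy_gaussianKernel [InnerProductSpace ℝ H] [CompleteSpace H]
    {s : ℝ} (hs : 0 < s) {a b : Measure H}
    [IsFiniteMeasure a] [IsFiniteMeasure b]
    (h : kernelEnergy (gaussianKernel s) (a.toSignedMeasure - b.toSignedMeasure) = 0) : a = b := by
  have : Fact (IsKernel (gaussianKernel s : H → H → ℝ)) := ⟨isKernel_gaussianKernel hs.le⟩
  have hm := measurable_gaussianKernel (H := H) s
  have hb := abs_gaussianKernel_le (H := H) hs.le
  rw [kernelEnergy_eq_norm_sq hm hb, sq_eq_zero_iff, norm_eq_zero] at h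
  refine measure_ext_of_integral_gaussianKernel hs fun v ↦ ?_
  have hint (m : Measure H) [IsFiniteMeasure m] :
      Integrable (fun u ↦ gaussianKernel s u v) m :=
    Integrable.of_bound (hm.comp (measurable_id.prodMk measurable_const)).aestronglyMeasurable 1
      (.of_forall fun u ↦ hb _ _)
  rw [← sub_eq_zero, ← integral_toSignedMeasure_sub (hint a) (hint b),
    ← kernelMeanEmbedding_apply hm hb, h]
  simp

/-! ### Mixtures of Gaussian kernels -/

/-- The mixture `∫ exp (-s ‖u - v‖²) dν(s)` of Gaussian kernels. -/
noncomputable def gaussianMixture {E : Type*} [NormedAddCommGroup E] (ν : Measure ℝ≥0) (u v : E) :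
    ℝ :=
  ∫ s : ℝ≥0, gaussianKernel s u v ∂ν

variable {ν : Measure ℝ≥0} [IsFiniteMeasure ν]

theorem integrable_gaussianKernel {E : Type*} [NormedAddCommGroup E] (u v : E) :
    Integrable (fun s : ℝ≥0 ↦ gaussianKernel s u v) ν := by
  refine Integrable.of_bound ?_ 1 (.of_forall fun s ↦ abs_gaussianKernel_le s.2 u v)
  unfold gaussianKernel
  fun_prop

theorem isKernel_gaussianMixture {E : Type*} [NormedAddCommGroup E] [InnerProductSpace ℝ E] :
    IsKernel (gaussianMixture ν : E → E → ℝ) :=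
  IsKernel.integral (fun s ↦ isKernel_gaussianKernel s.2) integrable_gaussianKernel

theorem abs_gaussianMixture_le {E : Type*} [NormedAddCommGroup E] (u v : E) :
    |gaussianMixture ν u v| ≤ ν.real Set.univ := by
  have := norm_integral_le_of_norm_le_const (μ := ν) (f := fun s : ℝ≥0 ↦ gaussianKernel s u v)
    (.of_forall fun s ↦ abs_gaussianKernel_le s.2 u v)
  simpa [gaussianMixture] using this

theorem measurable_gaussianKernel_joint :
    Measurable fun z : (H × H) × ℝ≥0 ↦ gaussianKernel (z.2 : ℝ) z.1.1 z.1.2 := by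
  unfold gaussianKernel
  fun_prop

theorem measurable_gaussianMixture :
    Measurable (Function.uncurry (gaussianMixture ν : H → H → ℝ)) :=
  (measurable_gaussianKernel_joint.stronglyMeasurable.integral_prod_right (ν := ν)).measurable

theorem integrable_gaussianKernel_prod (a b : Measure H) [IsFiniteMeasure a] [IsFiniteMeasure b] :
    Integrable (fun z : (H × H) × ℝ≥0 ↦ gaussianKernel (z.2 : ℝ) z.1.2 z.1.1)
      ((a.prod b).prod ν) :=
  Integrable.of_bound (measurable_gaussianKernel_joint.comp
    ((measurable_swap.comp measurable_fst).prodMk measurable_snd)).aestronglyMeasurable 1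
    (.of_forall fun z ↦ abs_gaussianKernel_le z.2.2 _ _)

theorem integral_gaussianMixture (a b : Measure H) [IsFiniteMeasure a] [IsFiniteMeasure b] :
    ∫ z, gaussianMixture ν z.2 z.1 ∂a.prod b =
      ∫ s : ℝ≥0, ∫ z, gaussianKernel (s : ℝ) z.2 z.1 ∂a.prod b ∂ν :=
  integral_integral_swap (integrable_gaussianKernel_prod a b)

theorem kernelEnergy_gaussianMixture (a b : Measure H) [IsFiniteMeasure a] [IsFiniteMeasure b] :
    Integrable (fun s : ℝ≥0 ↦
      kernelEnergy (gaussianKernel (s : ℝ)) (a.toSignedMeasure - b.toSignedMeasure)) ν ∧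
    kernelEnergy (gaussianMixture ν) (a.toSignedMeasure - b.toSignedMeasure) =
      ∫ s : ℝ≥0,
        kernelEnergy (gaussianKernel (s : ℝ)) (a.toSignedMeasure - b.toSignedMeasure) ∂ν := by
  have hs (s : ℝ≥0) := kernelEnergy_toSignedMeasure_sub (measurable_gaussianKernel (H := H) s)
    (abs_gaussianKernel_le s.2) a b
  have hint (a b : Measure H) [IsFiniteMeasure a] [IsFiniteMeasure b] :
      Integrable (fun s : ℝ≥0 ↦ ∫ z, gaussianKernel (s : ℝ) z.2 z.1 ∂a.prod b) ν :=
    (integrable_gaussianKernel_prod a b).integral_prod_right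
  have hsub (c : Measure H) [IsFiniteMeasure c] :
      Integrable (fun s : ℝ≥0 ↦ ∫ z, gaussianKernel (s : ℝ) z.2 z.1 ∂c.prod a -
        ∫ z, gaussianKernel (s : ℝ) z.2 z.1 ∂c.prod b) ν := (hint c a).sub (hint c b)
  simp only [hs]
  refine ⟨(hsub a).sub (hsub b), ?_⟩
  rw [kernelEnergy_toSignedMeasure_sub measurable_gaussianMixture abs_gaussianMixture_le,
    integral_sub (hsub a) (hsub b),
    integral_sub (hint a a) (hint a b), integral_sub (hint b a) (hint b b)]
  simp only [integral_gaussianMixture]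

/-- A nonzero measure without mass off `0` has support exactly `{0}`. -/
theorem measure_compl_zero_ne_zero {ν : Measure ℝ≥0} (h0 : ν ≠ 0) (hsupp : ν.support ≠ {0}) : ν {0}ᶜ ≠ 0 := by
  intro h
  refine hsupp (Set.Subset.antisymm
    (Measure.support_subset_of_isClosed isClosed_singleton (mem_ae_iff.2 h)) ?_)
  rintro _ rfl
  rw [Measure.mem_support_iff_forall]
  intro U hU
  by_contra hU0
  refine h0 (Measure.measure_univ_eq_zero.1 (measure_mono_null (t := U ∪ {0}ᶜ) (fun x _ ↦ ?_)
    (measure_union_null (by simpa using hU0) h)))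
  by_cases hx : x = 0
  · exact Or.inl (hx ▸ mem_of_mem_nhds hU)
  · exact Or.inr hx

theorem isIntegrallyStrictlyPosDef_gaussianMixture [InnerProductSpace ℝ H] [CompleteSpace H]
    (hν : ν {0}ᶜ ≠ 0) :
    IsIntegrallyStrictlyPosDef (gaussianMixture ν : H → H → ℝ) Set.univ := by
  refine .of_kernelEnergy isKernel_gaussianMixture measurable_gaussianMixture
    abs_gaussianMixture_le fun a b _ _ h ↦ ?_
  obtain ⟨hint, heq⟩ := kernelEnergy_gaussianMixture (ν := ν) a b
  rw [heq, integral_eq_zero_iff_of_nonneg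
    (fun s ↦ kernelEnergy_gaussianKernel_nonneg s.2 _) hint] at h
  obtain ⟨s, hs, hs0⟩ : ∃ s : ℝ≥0, kernelEnergy (gaussianKernel (s : ℝ))
      (a.toSignedMeasure - b.toSignedMeasure) = 0 ∧ s ≠ 0 := by
    by_contra! hcon
    refine hν (measure_mono_null (fun s hs ↦ ?_) h)
    exact fun h' ↦ hs (hcon s h')
  exact eq_of_kernelEnergy_gaussianKernel (by positivity) hs

end Gaussian

/-! ### Tightness of finite measures on spaces of finite measures -/

section Tight

open scoped ENNReal

variable {X : Type*} [TopologicalSpace X] [T2Space X] [LocallyCompactSpace X]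
  [MeasurableSpace X] [BorelSpace X]

/-- Inner regularity finds a compact `K ⊆ U` of mass above `c`, and Urysohn's lemma a continuous `g`
with `1_K ≤ g ≤ 1_U`. The weakly open condition `c < ∫ g` then defines a neighbourhood inside the
set. -/
theorem isOpen_setOf_lt_finiteMeasure (hreg : ∀ m : Measure X, IsFiniteMeasure m → m.Regular)
    {U : Set X} (hU : IsOpen U) (c : ℝ≥0∞) :
    IsOpen {μ : FiniteMeasure X | c < (μ : Measure X) U} := by
  refine isOpen_iff_mem_nhds.2 fun μ hμ ↦ ?_
  have := hreg μ inferInstance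
  obtain ⟨K, hKU, hK, hcK⟩ := hU.exists_lt_isCompact hμ
  obtain ⟨f, hf1, hf0, -, hf01⟩ := exists_continuous_one_zero_of_isCompact hK hU.isClosed_compl
    (Set.disjoint_compl_right_iff_subset.2 hKU)
  let g : BoundedContinuousFunction X ℝ≥0 := BoundedContinuousFunction.mkOfBound
    ⟨fun x ↦ (f x).toNNReal, by fun_prop⟩ 1 fun x y ↦ by
      have hx : f x ∈ Set.Icc (0 : ℝ) 1 := hf01 x
      have hy : f y ∈ Set.Icc (0 : ℝ) 1 := hf01 y
      rw [NNReal.dist_eq]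
      simp only [ContinuousMap.coe_mk, Real.coe_toNNReal _ hx.1, Real.coe_toNNReal _ hy.1]
      rw [abs_le]
      constructor <;> linarith [hx.1, hx.2, hy.1, hy.2]
  have hg (x : X) : g x = (f x).toNNReal := rfl
  have hopen : IsOpen {ν : FiniteMeasure X | c < ∫⁻ x, g x ∂(ν : Measure X)} :=
    isOpen_lt continuous_const
      (FiniteMeasure.continuous_lintegral_boundedContinuousFunction g)
  refine mem_of_superset (hopen.mem_nhds ?_) ?_
  · refine hcK.trans_le ?_
    rw [← lintegral_indicator_one hK.measurableSet]
    refine lintegral_mono fun x ↦ ?_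
    by_cases hx : x ∈ K
    · simp [hg, hx, hf1 hx]
    · simp [hx]
  · intro ν hν
    refine lt_of_lt_of_le (show c < ∫⁻ x, g x ∂(ν : Measure X) from hν) ?_
    rw [← lintegral_indicator_one hU.measurableSet]
    refine lintegral_mono fun x ↦ ?_
    by_cases hx : x ∈ U
    · simpa [hg, hx] using (hf01 x).2
    · simp [hg, hx, hf0 hx]

variable {M : Type*} [TopologicalSpace M] [MeasurableSpace M] [BorelSpace M]

theorem measurable_finiteMeasure_coe (hreg : ∀ m : Measure X, IsFiniteMeasure m → m.Regular)
    {ι : M → FiniteMeasure X} (hι : Continuous ι) : Measurable fun x ↦ (ι x : Measure X) := by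
  have hopen {U : Set X} (hU : IsOpen U) : Measurable fun x ↦ (ι x : Measure X) U :=
    measurable_of_Ioi fun c ↦ ((isOpen_setOf_lt_finiteMeasure hreg hU c).preimage hι).measurableSet
  exact .measure_of_isPiSystem (BorelSpace.measurable_eq.trans rfl) isPiSystem_isOpen
    (fun U hU ↦ hopen hU) (hopen isOpen_univ)

/-- Every finite Borel measure on a closed set of finite Radon measures is tight. -/
theorem exists_isCompact_measure_compl_le (hreg : ∀ m : Measure X, IsFiniteMeasure m → m.Regular)
    {ι : M → FiniteMeasure X} (hι : IsClosedEmbedding ι) (p : Measure M) [IsFiniteMeasure p]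
    {δ : ℝ≥0∞} (hδ : δ ≠ 0) : ∃ Γ : Set M, IsCompact Γ ∧ p Γᶜ ≤ δ := by
  have hmeas := measurable_finiteMeasure_coe hreg hι.continuous
  have hmass : Measurable fun x ↦ (ι x).mass :=
    (FiniteMeasure.continuous_mass.comp hι.continuous).measurable
  have hδ2 : δ / 2 ≠ 0 := (ENNReal.half_pos hδ).ne'
  -- Half of `δ` is spent on discarding measures of large total mass; the rest have mass at most
  -- `C`.
  obtain ⟨B, -, hB, hpB⟩ := MeasurableSet.univ.exists_isCompact_sdiff_lt
    (μ := p.map fun x ↦ (ι x).mass) (measure_ne_top _ _) hδ2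
  rw [← Set.compl_eq_univ_sdiff, Measure.map_apply hmass hB.measurableSet.compl] at hpB
  obtain ⟨C, hC⟩ := hB.bddAbove
  set A : Set M := (fun x ↦ (ι x).mass) ⁻¹' B with hA
  have hAm : MeasurableSet A := hmass hB.measurableSet
  -- The intensity measure: the `p`-average of the measures in `A`. The mass bound makes it finite,
  -- hence regular.
  set m : Measure X := (p.restrict A).bind fun x ↦ (ι x : Measure X) with hm
  have hm_apply {S : Set X} (hS : MeasurableSet S) :
      m S = ∫⁻ x in A, (ι x : Measure X) S ∂p := Measure.bind_apply hS hmeas.aemeasurable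
  have : IsFiniteMeasure m := by
    refine ⟨?_⟩
    rw [hm_apply .univ]
    refine (setLIntegral_mono measurable_const (g := fun _ ↦ (C : ℝ≥0∞)) fun x hx ↦ ?_).trans_lt ?_
    · rw [← FiniteMeasure.ennreal_mass]
      exact_mod_cast hC hx
    · rw [setLIntegral_const]
      exact ENNReal.mul_lt_top (by simp) (measure_lt_top _ _)
  have := hreg m this
  obtain ⟨u, -, hu_pos, hu⟩ := exists_seq_strictAnti_tendsto (0 : ℝ≥0)
  obtain ⟨ε, hε_pos, hε⟩ := ENNReal.exists_pos_sum_of_countable hδ2 ℕ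
  -- Markov's inequality at level `u n` divides the tolerance by `u n`, leaving `ε n`; these sum to
  -- less than `δ / 2`.
  have hL (n : ℕ) : ∃ L : Set X, IsCompact L ∧ m Lᶜ < ε n * u n := by
    have h0 : (ε n * u n : ℝ≥0∞) ≠ 0 :=
      mul_ne_zero (by exact_mod_cast (hε_pos n).ne') (by exact_mod_cast (hu_pos n).ne')
    obtain ⟨L, -, hL, hmL⟩ := MeasurableSet.univ.exists_isCompact_sdiff_lt
      (μ := m) (measure_ne_top _ _) h0
    exact ⟨L, hL, by rwa [Set.compl_eq_univ_sdiff]⟩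
  choose L hLc hLm using hL
  -- Finite unions make the compact sets increasing, as the compactness criterion below requires,
  -- and only shrink the complements.
  have hK (n : ℕ) : IsCompact (Set.accumulate L n) := by
    rw [Set.accumulate_def]
    exact (Set.finite_le_nat n).isCompact_biUnion fun i _ ↦ hLc i
  refine ⟨ι ⁻¹' {μ : FiniteMeasure X | μ.mass ≤ C ∧ ∀ n, μ (Set.accumulate L n)ᶜ ≤ u n},
    hι.isCompact_preimage (isCompact_setOfPred_finiteMeasure_mass_le_compl_isCompact_le C hu hK
      (Or.inr Set.monotone_accumulate)), ?_⟩
  set V : ℕ → Set M := fun n ↦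
    {x | (u n : ℝ≥0∞) ≤ (ι x : Measure X) (Set.accumulate L n)ᶜ} with hV
  have hVm (n : ℕ) : MeasurableSet (V n) := measurableSet_le measurable_const
    ((Measure.measurable_coe (hK n).measurableSet.compl).comp hmeas)
  have hpV (n : ℕ) : p (V n ∩ A) ≤ ε n := by
    have hmarkov : u n * p (V n ∩ A) ≤ m (Set.accumulate L n)ᶜ := by
      rw [hm_apply (hK n).measurableSet.compl, ← Measure.restrict_apply (hVm n)]
      exact mul_meas_ge_le_lintegral₀
        ((Measure.measurable_coe (hK n).measurableSet.compl).comp hmeas).aemeasurable _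
    have hle : u n * p (V n ∩ A) ≤ u n * ε n := by
      rw [mul_comm _ (ε n : ℝ≥0∞)]
      refine hmarkov.trans ((measure_mono ?_).trans (hLm n).le)
      exact Set.compl_subset_compl.2 (Set.subset_accumulate (s := L))
    exact (ENNReal.mul_le_mul_iff_right (by exact_mod_cast (hu_pos n).ne') (by simp)).1 hle
  calc p (ι ⁻¹' {μ | μ.mass ≤ C ∧ ∀ n, μ (Set.accumulate L n)ᶜ ≤ u n})ᶜ
      ≤ p (Aᶜ ∪ ⋃ n, V n ∩ A) := by
        refine measure_mono fun x hx ↦ ?_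
        by_contra hcon
        simp only [Set.mem_union, Set.mem_compl_iff, Set.mem_iUnion, not_or, not_not, not_exists,
          Set.mem_inter_iff, not_and] at hcon
        refine hx ⟨hC hcon.1, fun n ↦ ?_⟩
        have hn : ¬ (u n : ℝ≥0∞) ≤ (ι x : Measure X) (Set.accumulate L n)ᶜ :=
          fun h ↦ hcon.2 n h hcon.1
        rw [not_le, ← FiniteMeasure.ennreal_coeFn_eq_coeFn_toMeasure] at hn
        exact_mod_cast hn.le
    _ ≤ δ / 2 + ∑' n, (ε n : ℝ≥0∞) := by
        refine (measure_union_le _ _).trans (add_le_add hpB.le ?_)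
        exact (measure_iUnion_le _).trans (ENNReal.tsum_le_tsum hpV)
    _ ≤ δ := (add_le_add_right hε.le _).trans_eq (ENNReal.add_halves δ)

/-- Tight finite measures are determined by their push-forward under an injective, weakly
continuous map into a Hilbert space. -/
theorem measure_eq_of_map_eq {H : Type*} [NormedAddCommGroup H] [InnerProductSpace ℝ H]
    [MeasurableSpace H] [BorelSpace H] {F : M → H}
    (hF : ∀ w : H, Continuous fun x ↦ (inner ℝ w (F x) : ℝ)) (hFm : Measurable F)
    (hinj : Function.Injective F)
    (htight : ∀ (p : Measure M) [IsFiniteMeasure p] {δ : ℝ≥0∞}, δ ≠ 0 →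
      ∃ Γ : Set M, IsCompact Γ ∧ p Γᶜ ≤ δ)
    {p q : Measure M} [IsFiniteMeasure p] [IsFiniteMeasure q] (h : p.map F = q.map F) : p = q := by
  -- The map `v ↦ ⟪·, v⟫` into the product `ℝ^H` is continuous and injective. The image of `S` there
  -- is compact, hence closed, and `F '' S` is its preimage.
  have hclosed {S : Set M} (hS : IsCompact S) : IsClosed (F '' S) := by
    have hJ : Continuous fun (x : M) (w : H) ↦ (inner ℝ w (F x) : ℝ) := continuous_pi hF
    have hT : Continuous fun (v w : H) ↦ (inner ℝ w v : ℝ) := by fun_prop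
    have := (hS.image hJ).isClosed.preimage hT
    convert this using 1
    ext v
    constructor
    · rintro ⟨x, hx, rfl⟩
      exact ⟨x, hx, rfl⟩
    · rintro ⟨x, hx, hxv⟩
      exact ⟨x, hx, ext_inner_left ℝ fun w ↦ congrFun hxv w⟩
  have key {S : Set M} (hS : IsCompact S) : p S = q S := by
    rw [← hinj.preimage_image S, ← Measure.map_apply hFm (hclosed hS).measurableSet, h,
      Measure.map_apply hFm (hclosed hS).measurableSet]
  have hle {a b : Measure M} [IsFiniteMeasure a] (hab : ∀ S, IsCompact S → a S = b S) {C : Set M}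
      (hC : IsClosed C) : a C ≤ b C := by
    refine ENNReal.le_of_forall_pos_le_add fun ε hε _ ↦ ?_
    obtain ⟨Γ, hΓ, hΓa⟩ := htight a (δ := ε) (by exact_mod_cast hε.ne')
    calc a C ≤ a (C ∩ Γ ∪ Γᶜ) := measure_mono fun x hx ↦ by
            by_cases hxΓ : x ∈ Γ
            · exact Or.inl ⟨hx, hxΓ⟩
            · exact Or.inr hxΓ
      _ ≤ a (C ∩ Γ) + a Γᶜ := measure_union_le _ _
      _ ≤ b C + ε := by
          rw [hab _ (hΓ.inter_left hC)]
          exact add_le_add (measure_mono Set.inter_subset_left) hΓa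
  have heq {C : Set M} (hC : IsClosed C) : p C = q C :=
    le_antisymm (hle (fun S hS ↦ key hS) hC) (hle (fun S hS ↦ (key hS).symm) hC)
  exact ext_of_generate_finite _ (BorelSpace.measurable_eq.trans borel_eq_generateFrom_isClosed)
    isPiSystem_isClosed (fun C hC ↦ heq hC) (heq isClosed_univ)

end Tight

/-! ### The embedding of finite measures into the Hilbert space of the base kernel -/

/-- Closed balls are intersections of half-spaces, so their preimages are closed. Separability
writes each open set as a countable union of open balls. -/
theorem measurable_of_continuous_inner {M H : Type*} [TopologicalSpace M] [MeasurableSpace M]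
    [BorelSpace M] [NormedAddCommGroup H] [InnerProductSpace ℝ H] [SecondCountableTopology H]
    [MeasurableSpace H] [BorelSpace H] {F : M → H}
    (hF : ∀ w : H, Continuous fun x ↦ (inner ℝ w (F x) : ℝ)) : Measurable F := by
  have hnorm (c : H) : Measurable fun x ↦ ‖F x - c‖ := by
    refine measurable_of_Iic fun r ↦ IsClosed.measurableSet ?_
    rcases lt_or_ge r 0 with hr | hr
    · convert isClosed_empty
      exact Set.eq_empty_of_forall_notMem fun x hx ↦
        (norm_nonneg (F x - c)).not_gt (lt_of_le_of_lt hx hr)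
    have : (fun x ↦ ‖F x - c‖) ⁻¹' Set.Iic r =
        ⋂ w : H, {x | inner ℝ w (F x) - inner ℝ w c ≤ ‖w‖ * r} := by
      ext x
      simp only [Set.mem_preimage, Set.mem_Iic, Set.mem_iInter, Set.mem_ofPred_eq,
        ← inner_sub_right]
      refine ⟨fun h w ↦ (real_inner_le_norm _ _).trans (by gcongr), fun h ↦ ?_⟩
      have hx := h (F x - c)
      rw [real_inner_self_eq_norm_mul_norm] at hx
      by_contra! hcon
      nlinarith
    rw [this]
    exact isClosed_iInter fun w ↦ isClosed_le ((hF w).sub continuous_const) continuous_const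
  refine measurable_of_isOpen fun U hU ↦ ?_
  choose! r hr hrU using Metric.isOpen_iff.1 hU
  obtain ⟨T, hTU, hT, hTeq⟩ := TopologicalSpace.isOpen_biUnion_countable U
    (fun c ↦ Metric.ball c (r c)) fun _ _ ↦ Metric.isOpen_ball
  have hUeq : U = ⋃ c ∈ T, Metric.ball c (r c) := by
    rw [hTeq]
    exact Set.Subset.antisymm
      (fun c hc ↦ Set.mem_biUnion hc (Metric.mem_ball_self (hr c hc))) (Set.iUnion₂_subset hrU)
  rw [hUeq, Set.preimage_iUnion₂]
  refine MeasurableSet.biUnion hT fun c _ ↦ ?_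
  convert hnorm c (measurableSet_Iio (a := r c)) using 1
  ext x
  simp [dist_eq_norm]

theorem continuous_featureMap {X : Type*} [TopologicalSpace X] {k : X → X → ℝ} [Fact (IsKernel k)]
    (hk : Continuous (Function.uncurry k)) : Continuous (featureMap k) := by
  refine continuous_iff_continuousAt.2 fun x ↦ ?_
  have hsq (y : X) : ‖featureMap k y - featureMap k x‖ ^ 2 = k y y - 2 * k x y + k x x := by
    rw [norm_sub_sq_real, norm_featureMap_sq, norm_featureMap_sq, inner_featureMap,
      featureMap_apply]
  have hlim : Tendsto (fun y ↦ √(k y y - 2 * k x y + k x x)) (𝓝 x) (𝓝 0) := by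
    have hc : Continuous fun y ↦ √(k y y - 2 * k x y + k x x) := by
      have h1 : Continuous fun y ↦ k y y := hk.comp (continuous_id.prodMk continuous_id)
      have h2 : Continuous fun y ↦ k x y := hk.comp (continuous_const.prodMk continuous_id)
      fun_prop
    convert hc.tendsto x
    rw [show k x x - 2 * k x x + k x x = 0 by ring, Real.sqrt_zero]
  refine tendsto_iff_norm_sub_tendsto_zero.2 (hlim.congr fun y ↦ ?_)
  rw [← hsq, Real.sqrt_sq (norm_nonneg _)]

section Deep

variable {X : Type*} [MeasurableSpace X] {k : X → X → ℝ} [Fact (IsKernel k)]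

theorem kernelMeanEmbedding_finiteMeasure_injective
    (hpd : IsIntegrallyStrictlyPosDef k Set.univ) {C : ℝ} (hC : ∀ x y, |k x y| ≤ C) :
    Function.Injective fun μ : FiniteMeasure X ↦
      kernelMeanEmbedding k (μ : Measure X).toSignedMeasure := by
  intro μ ν h
  refine Subtype.ext (hpd.eq_of_kernelEnergy hC (p := (μ : Measure X)) (q := (ν : Measure X)) ?_)
  rw [kernelEnergy_eq_norm_sq hpd.1 hC, kernelMeanEmbedding_sub hpd.1 hC]
  simp only at h
  rw [h, sub_self, norm_zero, zero_pow two_ne_zero]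

theorem deepKernel_eq (hk : Measurable (Function.uncurry k)) {C : ℝ} (hC : ∀ x y, |k x y| ≤ C)
    (φ : ℝ → ℝ) (μ ν : FiniteMeasure X) : deepKernel k φ μ ν =
      φ (‖kernelMeanEmbedding k (μ : Measure X).toSignedMeasure
        - kernelMeanEmbedding k (ν : Measure X).toSignedMeasure‖ ^ 2) := by
  rw [deepKernel, kernelEnergy_eq_norm_sq hk hC, kernelMeanEmbedding_sub hk hC]

variable [TopologicalSpace X] [BorelSpace X]

/-- The inner product with `w` is the integral of `w`, which is a bounded continuous function
because `k` is bounded and continuous. -/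
theorem continuous_inner_kernelMeanEmbedding (hcont : Continuous (Function.uncurry k))
    (hk : Measurable (Function.uncurry k)) {C : ℝ} (hC : ∀ x y, |k x y| ≤ C) (w : KernelSpace k) :
    Continuous fun μ : FiniteMeasure X ↦
      (inner ℝ w (kernelMeanEmbedding k (μ : Measure X).toSignedMeasure) : ℝ) := by
  have hw : Continuous (w : X → ℝ) := by
    have : (w : X → ℝ) = fun x ↦ inner ℝ w (featureMap k x) := by
      ext x
      rw [inner_featureMap]
    rw [this]
    exact continuous_const.inner (continuous_featureMap hcont)
  let g : BoundedContinuousFunction X ℝ := BoundedContinuousFunction.ofNormedAddCommGroup w hw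
    (‖w‖ * √C) fun x ↦ KernelSpace.abs_apply_le hC w x
  simp only [inner_kernelMeanEmbedding hk hC, VectorMeasure.integral_toSignedMeasure]
  exact FiniteMeasure.continuous_integral_boundedContinuousFunction g

/-- A Gaussian mixture of mean embeddings is integrally strictly positive definite on every closed
set of finite Radon measures. -/
theorem isIntegrallyStrictlyPosDef_gaussianMixture_kernelMeanEmbedding [T2Space X]
    [LocallyCompactSpace X] (hreg : ∀ m : Measure X, IsFiniteMeasure m → m.Regular)
    (hcont : Continuous (Function.uncurry k))
    (hpd : IsIntegrallyStrictlyPosDef k Set.univ) {C : ℝ} (hC : ∀ x y, |k x y| ≤ C)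
    [SecondCountableTopology (KernelSpace k)] {ν : Measure ℝ≥0} [IsFiniteMeasure ν]
    (hν : ν {0}ᶜ ≠ 0) {M : Type*} [TopologicalSpace M] [MeasurableSpace M] [BorelSpace M]
    {ι : M → FiniteMeasure X} (hι : IsClosedEmbedding ι) :
    IsIntegrallyStrictlyPosDef (fun x y ↦ gaussianMixture ν
      (kernelMeanEmbedding k (ι x : Measure X).toSignedMeasure)
      (kernelMeanEmbedding k (ι y : Measure X).toSignedMeasure)) Set.univ := by
  borelize (KernelSpace k)
  have hF (w : KernelSpace k) := (continuous_inner_kernelMeanEmbedding hcont hpd.1 hC w).comp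
    hι.continuous
  have hFm := measurable_of_continuous_inner hF
  exact (isIntegrallyStrictlyPosDef_gaussianMixture hν).comp abs_gaussianMixture_le hFm
    fun p q _ _ h ↦ measure_eq_of_map_eq hF hFm
      ((kernelMeanEmbedding_finiteMeasure_injective hpd hC).comp hι.injective)
      (fun p _ _ hδ ↦ exists_isCompact_measure_compl_le hreg hι p hδ) h

end Deep

/-! ### Probability measures as a closed subspace, and the conclusion -/

theorem isClosedEmbedding_toFiniteMeasure (X : Type*) [TopologicalSpace X] [MeasurableSpace X]
    [OpensMeasurableSpace X] :
    IsClosedEmbedding (ProbabilityMeasure.toFiniteMeasure : ProbabilityMeasure X → _) := by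
  refine ⟨ProbabilityMeasure.toFiniteMeasure_isEmbedding X, ?_⟩
  have : Set.range (ProbabilityMeasure.toFiniteMeasure : ProbabilityMeasure X → _) =
      {μ : FiniteMeasure X | μ.mass = 1} := by
    ext μ
    refine ⟨?_, fun h ↦ ⟨⟨μ, ⟨?_⟩⟩, rfl⟩⟩
    · rintro ⟨μ, rfl⟩
      exact μ.mass_toFiniteMeasure
    · rw [← FiniteMeasure.ennreal_mass, show μ.mass = 1 from h, ENNReal.coe_one]
  rw [this]
  exact isClosed_eq FiniteMeasure.continuous_mass continuous_const

theorem mainTheorem5 {X : Type*} [TopologicalSpace X] [T2Space X] [LocallyCompactSpace X]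
    [MeasurableSpace X] [BorelSpace X]
    (k₁ : X → X → ℝ) [Fact (IsKernel k₁)]
    (hbdd : ∃ C : ℝ, ∀ x y, |k₁ x y| ≤ C)
    (hcont : Continuous (Function.uncurry k₁))
    (hpd : IsIntegrallyStrictlyPosDef k₁ Set.univ)
    (hsep : TopologicalSpace.SeparableSpace (KernelSpace k₁))
    (φ : ℝ → ℝ) (hφ : φ ∈ PhiInftyPlus) :
    (IsKernel (deepKernel k₁ φ) ∧
      ∀ μ ν : FiniteMeasure X, deepKernel k₁ φ μ ν =
        φ (‖kernelMeanEmbedding k₁ (μ : Measure X).toSignedMeasure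
          - kernelMeanEmbedding k₁ (ν : Measure X).toSignedMeasure‖ ^ 2)) ∧
    ((∀ m : Measure X, IsFiniteMeasure m → m.Regular) →
      IsIntegrallyStrictlyPosDef (mX := borel (ProbabilityMeasure X))
        (deepKernelProb k₁ φ) Set.univ) ∧
    (PolishSpace X →
      IsIntegrallyStrictlyPosDef (mX := borel (FiniteMeasure X))
        (deepKernel k₁ φ) Set.univ) := by
  obtain ⟨C, hC⟩ := hbdd
  obtain ⟨ν, hν, hν0, hsupp, hφν⟩ := hφ
  have hν1 := measure_compl_zero_ne_zero hν0 hsupp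
  have : SecondCountableTopology (KernelSpace k₁) :=
    UniformSpace.secondCountable_of_separable _
  have hmix (μ ρ : FiniteMeasure X) : deepKernel k₁ φ μ ρ = gaussianMixture ν
      (kernelMeanEmbedding k₁ (μ : Measure X).toSignedMeasure)
      (kernelMeanEmbedding k₁ (ρ : Measure X).toSignedMeasure) := by
    rw [deepKernel_eq hpd.1 hC, hφν _ (by positivity)]
    rfl
  have hdeep : deepKernel k₁ φ = fun μ ρ : FiniteMeasure X ↦ gaussianMixture ν
      (kernelMeanEmbedding k₁ (μ : Measure X).toSignedMeasure)
      (kernelMeanEmbedding k₁ (ρ : Measure X).toSignedMeasure) :=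
    funext fun μ ↦ funext fun ρ ↦ hmix μ ρ
  refine ⟨⟨?_, deepKernel_eq hpd.1 hC φ⟩, fun hreg ↦ ?_, fun hpolish ↦ ?_⟩
  · rw [hdeep]
    exact isKernel_gaussianMixture.comp fun μ : FiniteMeasure X ↦
      kernelMeanEmbedding k₁ (μ : Measure X).toSignedMeasure
  · let _ : MeasurableSpace (ProbabilityMeasure X) := borel _
    have : BorelSpace (ProbabilityMeasure X) := ⟨rfl⟩
    have := isIntegrallyStrictlyPosDef_gaussianMixture_kernelMeanEmbedding hreg hcont hpd hC hν1
      (isClosedEmbedding_toFiniteMeasure X)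
    simp only [← hmix] at this
    exact this
  · let _ : MeasurableSpace (FiniteMeasure X) := borel _
    have : BorelSpace (FiniteMeasure X) := ⟨rfl⟩
    -- On a Polish space finite Borel measures are regular, so the general result applies to all of
    -- `M₊(X)`.
    have := TopologicalSpace.upgradeIsCompletelyMetrizable X
    rw [hdeep]
    exact isIntegrallyStrictlyPosDef_gaussianMixture_kernelMeanEmbedding
      (fun m _ ↦ inferInstance) hcont hpd hC hν1 IsClosedEmbedding.id
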